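/- Let $G$ be a finite group, let $n\ge 2$, and let $P\le G$ be a wreathed $2$-group $P\cong C_{2^n}\wr C_2$; that is, $P=(\langle a\rangle\times\langle b\rangle)\rtimes\langle t\rangle$ with $a,b$ of order $2^n$, $t$ of order $2$, $t^{-1}at=b$ and $t^{-1}bt=a$. Let $\mathcal F_P(G)$ be the fusion system of $G$ over $P$: its objects are the subgroups of $P$ and its morphisms are the homomorphisms between them induced by conjugation by elements of $G$. Assume that $\mathcal F_P(G)$ is saturated. Let $Q\le P$ be one of the following subgroups: - $Q=\langle a^{2^m}\rangle\times\langle b^{2^m}\rangle$ for some $0\le m\le n-1$; - $Q=YK\cong Q_8*C_{2^m}$ for some $1\le m\le n$, where $Y\le P$, $Y\cong Q_8$, and $K\le Z(P)$ is cyclic of order $2^m$ (here $*$ denotes the central product, and $Q_8*C_2\cong Q_8$). Assume that $Q$ is fully $\mathcal F_P(G)$-normalized, i.e. $|N_P(R)|\le|N_P(Q)|$ for every subgroup $R\le P$ that is $G$-conjugate to $Q$. Assume moreover that $C_G(Q)$ is $2$-nilpotent and that $N_G(Q)/Q\,C_G(Q)$ is not a $2$-group. Then there exists a subgroup $H_Q$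 of $N_G(Q)$ such that $N_P(Q)$ is a Sylow $2$-subgroup of $H_Q$ and $|N_G(Q):H_Q|$ is a power of $2$ (possibly $1$). -/

import Mathlib

/-! ## Fusion systems of finite groups

For a subgroup `P` of a finite group `G`, the fusion system `F_P(G)` is the category whose objects
are the subgroups of `P` and whose morphisms are the homomorphisms induced by conjugation with
elements of `G`. All objects are written here as subgroups of `G` that are contained in `P`. -/

namespace FusionSys

variable {G : Type*} [Group G]

/-- `A` is a Sylow `p`-subgroup of `B`, for subgroups `A`, `B` of a group. -/
def IsSylowIn (p : ℕ) (A B : Subgroup G) : Prop :=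
  A ≤ B ∧ ∃ S : Sylow p B, (S : Subgroup B) = A.subgroupOf B

/-- The morphisms `Q → R` of the fusion system `F_P(G)`, for `Q, R ≤ P`: the homomorphisms
`x ↦ g x g⁻¹` with `g ∈ G` such that `g Q g⁻¹ ≤ R`. -/
def Hom (Q R : Subgroup G) : Set (Q →* R) :=
  {φ | ∃ g : G, ∀ x : Q, (φ x : G) = g * (x : G) * g⁻¹}

/-- The isomorphisms `Q → R` of the fusion system `F_P(G)`, for `Q, R ≤ P`. The inverse of
conjugation by `g` is conjugation by `g⁻¹`, so it is again a morphism. -/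
def Iso (Q R : Subgroup G) : Set (Q ≃* R) :=
  {φ | ∃ g : G, ∀ x : Q, (φ x : G) = g * (x : G) * g⁻¹}

/-- `Aut_K(Q) = N_K(Q) / C_K(Q)`, as the group of the automorphisms of `Q` that are induced by
conjugation with elements of `N_K(Q)`. In `F_P(G)` the automorphism group of `Q ≤ P` is
`Aut_G(Q)`, that is `autBy ⊤ Q`. -/
def autBy (K Q : Subgroup G) : Subgroup (MulAut Q) :=
  (K.subgroupOf (Subgroup.normalizer (Q : Set G))).map Q.normalizerMonoidHom

/-- `Q` and `R` (subgroups of `P`) are isomorphic in `F_P(G)`. -/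
def Conj (Q R : Subgroup G) : Prop := (Iso Q R).Nonempty

/-- `Q` is fully normalized in `F_P(G)`. -/
def FullyNormalized (P Q : Subgroup G) : Prop :=
  Q ≤ P ∧ ∀ R : Subgroup G, R ≤ P → Conj Q R →
    Nat.card (P ⊓ Subgroup.normalizer (R : Set G) : Subgroup G) ≤
      Nat.card (P ⊓ Subgroup.normalizer (Q : Set G) : Subgroup G)

/-- `Q` is fully automized in `F_P(G)`: `Aut_P(Q)` is a Sylow `p`-subgroup of `Aut_G(Q)`. -/
def FullyAutomized (p : ℕ) (P Q : Subgroup G) : Prop :=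
  IsSylowIn p (autBy P Q) (autBy ⊤ Q)

/-- `N_φ = {g ∈ N_P(Q) : φ ∘ c_g ∘ φ⁻¹ ∈ Aut_P(R)}` for an isomorphism `φ : Q → R`. -/
def extender (P : Subgroup G) {Q R : Subgroup G} (φ : Q ≃* R) : Subgroup G :=
  P ⊓ ((autBy P R).comap
    ((MulAut.congr φ).toMonoidHom.comp Q.normalizerMonoidHom)).map
      (Subgroup.normalizer (Q : Set G)).subtype

/-- `R` is receptive in `F_P(G)`: each isomorphism `φ : Q → R` of `F_P(G)` extends to a morphism
`N_φ → P` of `F_P(G)`. (One has `Q ≤ N_φ`, see `le_extender`.) -/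
def Receptive (P R : Subgroup G) : Prop :=
  ∀ Q : Subgroup G, Q ≤ P → ∀ φ : Q ≃* R, φ ∈ Iso Q R →
    ∃ ψ : extender P φ →* P, ψ ∈ Hom (extender P φ) P ∧
      ∀ (x : Q) (hx : (x : G) ∈ extender P φ), (ψ ⟨(x : G), hx⟩ : G) = (φ x : G)

/-- The fusion system `F_P(G)` is saturated (with respect to the prime `p`): each subgroup of `P`
is isomorphic in `F_P(G)` to a subgroup of `P` that is fully automized and receptive. -/
def Saturated (p : ℕ) (P : Subgroup G) : Prop :=
  ∀ Q : Subgroup G, Q ≤ P →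
    ∃ R : Subgroup G, R ≤ P ∧ Conj Q R ∧ FullyAutomized p P R ∧ Receptive P R

theorem mem_autBy {K Q : Subgroup G} {α : MulAut Q} :
    α ∈ autBy K Q ↔ ∃ g ∈ K, ∀ x : Q, ((α x : Q) : G) = g * (x : G) * g⁻¹ := by
  constructor
  · rintro ⟨g, hg, rfl⟩
    exact ⟨g, hg, fun x => rfl⟩
  · rintro ⟨g, hg, h⟩
    have hn : g ∈ Subgroup.normalizer (Q : Set G) := by
      intro x
      constructor
      · intro hx
        have := h ⟨x, hx⟩
        exact this ▸ (α ⟨x, hx⟩).2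
      · intro hx
        have := h (α.symm ⟨_, hx⟩)
        rw [MulEquiv.apply_symm_apply] at this
        have h2 : x = (α.symm ⟨_, hx⟩ : Q) := by
          simpa using this
        rw [h2]
        exact (α.symm ⟨_, hx⟩ : Q).2
    refine ⟨⟨g, hn⟩, hg, ?_⟩
    ext x
    exact (h x).symm

theorem mem_extender {P Q R : Subgroup G} {φ : Q ≃* R} {g : G} :
    g ∈ extender P φ ↔ g ∈ P ∧ ∃ hg : g ∈ Subgroup.normalizer (Q : Set G),
      MulAut.congr φ (Q.normalizerMonoidHom ⟨g, hg⟩) ∈ autBy P R := by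
  constructor
  · rintro ⟨hP, ⟨y, hy⟩, h, rfl⟩
    exact ⟨hP, hy, h⟩
  · rintro ⟨hP, hg, h⟩
    exact ⟨hP, ⟨g, hg⟩, h, rfl⟩

theorem le_extender {P Q R : Subgroup G} (hQ : Q ≤ P) (hR : R ≤ P) (φ : Q ≃* R) :
    Q ≤ extender P φ := by
  intro g hg
  refine mem_extender.2 ⟨hQ hg, Subgroup.le_normalizer hg, mem_autBy.2
    ⟨φ ⟨g, hg⟩, hR (φ ⟨g, hg⟩).2, fun x => ?_⟩⟩
  have : MulAut.congr φ (Q.normalizerMonoidHom ⟨g, Subgroup.le_normalizer hg⟩) x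
      = φ (⟨g, hg⟩ * φ.symm x * ⟨g, hg⟩⁻¹) := rfl
  rw [this]
  simp

/-- A group is `p`-nilpotent if it has a normal `p`-complement: a normal subgroup of order prime
to `p` and of `p`-power index. -/
def IsPNilpotent (p : ℕ) (X : Type*) [Group X] : Prop :=
  ∃ K : Subgroup X, K.Normal ∧ (Nat.card K).Coprime p ∧ ∃ k : ℕ, K.index = p ^ k

/-- `Q C_G(Q)`, as a subgroup of `N_G(Q)`. -/
def mulCentralizer (Q : Subgroup G) : Subgroup (Subgroup.normalizer (Q : Set G)) :=
  (Q ⊔ Subgroup.centralizer (Q : Set G)).subgroupOf (Subgroup.normalizer (Q : Set G))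

instance mulCentralizer_normal (Q : Subgroup G) : (mulCentralizer Q).Normal := by
  unfold mulCentralizer
  rw [Subgroup.subgroupOf_sup Subgroup.le_normalizer (Subgroup.centralizer_le_normalizer _)]
  infer_instance

/-! ## Wreathed 2-groups -/

/-- The wreath product `C_{2^n} ≀ C_2`. -/
abbrev Wreathed (n : ℕ) : Type :=
  Multiplicative (ZMod (2 ^ n)) ≀ᵣ Multiplicative (ZMod 2)

/-- The generator `a` of the first factor of the base subgroup `⟨a⟩ × ⟨b⟩` of `C_{2^n} ≀ C_2`. -/
def wrA (n : ℕ) : Wreathed n :=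
  ⟨Pi.mulSingle (Multiplicative.ofAdd 0) (Multiplicative.ofAdd 1), 1⟩

/-- The generator `b` of the second factor of the base subgroup `⟨a⟩ × ⟨b⟩` of
`C_{2^n} ≀ C_2`. -/
def wrB (n : ℕ) : Wreathed n :=
  ⟨Pi.mulSingle (Multiplicative.ofAdd 1) (Multiplicative.ofAdd 1), 1⟩

/-- For a subgroup `P` of `G` identified by `e` with `C_{2^n} ≀ C_2`, the subgroup
`⟨a^(2^m)⟩ × ⟨b^(2^m)⟩ ≅ C_{2^(n-m)} × C_{2^(n-m)}` of the base subgroup. -/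
def homocyclic {P : Subgroup G} {n : ℕ} (e : P ≃* Wreathed n) (m : ℕ) : Subgroup G :=
  (Subgroup.zpowers (wrA n ^ 2 ^ m) ⊔ Subgroup.zpowers (wrB n ^ 2 ^ m)).map
    (P.subtype.comp e.symm.toMonoidHom)

/-- `Q = Y K`, where `Y ≤ P` is isomorphic to `Q_8` and `K ≤ Z(P)` is cyclic of order `2^m`. -/
def IsQuaternionCentralProduct (P Q : Subgroup G) (m : ℕ) : Prop :=
  ∃ Y K : Subgroup G, Y ≤ P ∧ Nonempty (Y ≃* QuaternionGroup 2) ∧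
    K ≤ (Subgroup.center P).map P.subtype ∧ IsCyclic K ∧ Nat.card K = 2 ^ m ∧ Q = Y ⊔ K

/-- `Q` is a homocyclic subgroup `⟨a^(2^m)⟩ × ⟨b^(2^m)⟩` of the base subgroup with
`0 ≤ m ≤ n - 1`, or a subgroup `Y K ≅ Q_8 * C_{2^m}` with `1 ≤ m ≤ n`. -/
def IsListed {P : Subgroup G} {n : ℕ} (e : P ≃* Wreathed n) (Q : Subgroup G) : Prop :=
  (∃ m < n, Q = homocyclic e m) ∨
    ∃ m, 1 ≤ m ∧ m ≤ n ∧ IsQuaternionCentralProduct P Q m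

end FusionSys

open Equiv (Perm)

namespace FusionSys

/-! Write `N = N_G(Q)`, `C = C_G(Q)`, `T = N_P(Q)`, and let `K` be the normal 2-complement of `C`;
it is normal in `N`. For each listed `Q` there is a homomorphism from `Aut(Q)` to `S_3` whose kernel
is a 2-group (`exists_perm_hom_of_isListed`): act on the involutions of a homocyclic `Q`, or on the
nontrivial elements of `Q/Z(Q)` when `Q = YK`. It induces `f : N → S_3`. With `L = ker f`, the
quotient `L/K` is a 2-group, and since `N/QC` is not a 2-group some `f x` has order 3.

A fully normalized `Q` can be carried, together with `T`, to a fully automized receptive subgroup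
(`FullyNormalized.exists_conj`), so it inherits two properties. The Sylow property gives `L ≤ TC`.
Put `D = T ∩ L`; as `x` conjugates `D` into `TC`, the extension property yields `h ∈ xC` that
normalizes `D`.

Now `T` and `h` normalize `E = DK`. Modulo `E` the image of `T` is `T/D`, which embeds in `S_3` and
so has order at most 2; it therefore normalizes a subgroup of order 3
(`exists_orderOf_eq_three_normalized`). The preimage `H` of their product has order `3|K||T|`, so
`T` is Sylow in `H`. As `|N : K|` divides `6|L : K|`, the only factor 3 is used up in `H`, and `|N :
H|` is a power of 2 (`exists_sylow_two_power_index`). -/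

/-! ### Groups mapping to `S_3` with 2-power kernel -/

theorem eq_one_of_pow_three_of_two_pow {M : Type*} [Group M] {x : M} {k : ℕ}
    (h3 : x ^ 3 = 1) (h2 : x ^ 2 ^ k = 1) : x = 1 := by
  have h : orderOf x ∣ Nat.gcd 3 (2 ^ k) :=
    Nat.dvd_gcd (orderOf_dvd_of_pow_eq_one h3) (orderOf_dvd_of_pow_eq_one h2)
  rw [Nat.Coprime.pow_right k (by norm_num : Nat.Coprime 3 2)] at h
  exact orderOf_eq_one_iff.1 (Nat.dvd_one.1 h)

theorem perm_sq_or_cube : ∀ σ : Perm (Fin 3), σ ^ 2 = 1 ∨ σ ^ 3 = 1 := by decide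

/-- `S_3` has no Klein four-subgroup; this bounds the 2-group `S` below by order 2. -/
theorem perm_klein : ∀ σ τ : Perm (Fin 3), σ ^ 2 = 1 → τ ^ 2 = 1 → (σ * τ) ^ 2 = 1 →
    σ = 1 ∨ τ = 1 ∨ σ * τ = 1 := by decide

-- A 3-cycle moves a transposition to a different one, and the product of two distinct
-- transpositions is a 3-cycle.
set_option maxRecDepth 4000 in
theorem perm_mul_conj : ∀ σ τ : Perm (Fin 3), σ ≠ 1 ∧ σ ^ 2 = 1 ∧ τ ≠ 1 ∧ τ ^ 3 = 1 →
    (σ * (τ * σ * τ⁻¹)) ≠ 1 ∧ (σ * (τ * σ * τ⁻¹)) ^ 3 = 1 := by decide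

/-- An element of order three in the image has a preimage of order three, which may be chosen as a
power of any given preimage. -/
theorem exists_two_pow_orderOf_eq_three {M : Type*} [Group M] (f : M →* Perm (Fin 3))
    (hker : ∀ z, f z = 1 → ∃ k : ℕ, z ^ 2 ^ k = 1) (x : M) (h3 : f x ^ 3 = 1) (h1 : f x ≠ 1) :
    ∃ k : ℕ, orderOf (x ^ 2 ^ k) = 3 := by
  obtain ⟨k, hk⟩ := hker (x ^ 3) (by rw [map_pow, h3])
  refine ⟨k, orderOf_eq_prime (by rw [← pow_mul, mul_comm, pow_mul, hk]) fun h => h1 ?_⟩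
  exact eq_one_of_pow_three_of_two_pow h3 (k := k) (by rw [← map_pow, h, map_one])

/-- `S` embeds in `S_3`, so it is trivial or generated by an involution `t`. In the second case `t`
and its conjugate by `x` generate a dihedral group; `t` inverts their product, and a power of that
product has order 3. -/
theorem exists_orderOf_eq_three_normalized {M : Type*} [Group M] (f : M →* Perm (Fin 3))
    (hker : ∀ z, f z = 1 → ∃ k : ℕ, z ^ 2 ^ k = 1) (S : Subgroup M) (hS : IsPGroup 2 S)
    (hSf : ∀ s ∈ S, f s = 1 → s = 1) (x : M) (h3 : f x ^ 3 = 1) (h1 : f x ≠ 1) :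
    ∃ y : M, orderOf y = 3 ∧ ∀ s ∈ S, s * y * s⁻¹ ∈ Subgroup.zpowers y := by
  by_cases hbot : ∀ s ∈ S, s = 1
  · obtain ⟨k, hk⟩ := exists_two_pow_orderOf_eq_three f hker x h3 h1
    refine ⟨_, hk, fun s hs => ?_⟩
    rw [hbot s hs]
    simp
  push Not at hbot
  obtain ⟨t, htS, ht1⟩ := hbot
  have hsq : ∀ s ∈ S, f s ^ 2 = 1 := by
    intro s hs
    rcases perm_sq_or_cube (f s) with h | h
    · exact h
    · obtain ⟨k, hk⟩ := hS ⟨s, hs⟩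
      have hk' : s ^ 2 ^ k = 1 := congrArg Subtype.val hk
      rw [eq_one_of_pow_three_of_two_pow h (k := k) (by rw [← map_pow, hk', map_one]), one_pow]
  have ht2 : t * t = 1 := hSf _ (mul_mem htS htS) (by rw [map_mul, ← sq, hsq t htS])
  have htinv : t⁻¹ = t := inv_eq_of_mul_eq_one_left ht2
  have hft : f t ≠ 1 := fun h => ht1 (hSf t htS h)
  obtain ⟨hu1, hu3⟩ := perm_mul_conj (f t) (f x) ⟨hft, hsq t htS, h1, h3⟩
  obtain ⟨k, hk⟩ := exists_two_pow_orderOf_eq_three f hker (t * (x * t * x⁻¹))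
    (by simpa using hu3) (by simpa using hu1)
  set u := t * (x * t * x⁻¹) with hu
  refine ⟨_, hk, fun s hs => ?_⟩
  have hinv : t * u * t⁻¹ = u⁻¹ := by
    rw [hu]
    simp only [mul_inv_rev, htinv, inv_inv]
    simp only [← mul_assoc, ht2, one_mul]
  have htu : t * u ^ 2 ^ k * t⁻¹ ∈ Subgroup.zpowers (u ^ 2 ^ k) := by
    rw [← conj_pow, hinv, inv_pow]
    exact inv_mem (Subgroup.mem_zpowers _)
  rcases perm_klein (f s) (f t) (hsq s hs) (hsq t htS)
    (by rw [← map_mul]; exact hsq _ (mul_mem hs htS)) with h | h | h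
  · rw [hSf s hs h]
    simp
  · exact absurd h hft
  · have hst : s * t = 1 := hSf _ (mul_mem hs htS) (by rw [map_mul, h])
    rw [eq_inv_of_mul_eq_one_left hst, htinv]
    exact htu

theorem exists_subgroup_card_eq_three_mul {M : Type*} [Group M] [Finite M]
    (f : M →* Perm (Fin 3))
    (hker : ∀ z, f z = 1 → ∃ k : ℕ, z ^ 2 ^ k = 1) (S : Subgroup M) (hS : IsPGroup 2 S)
    (hSf : ∀ s ∈ S, f s = 1 → s = 1) (x : M) (h3 : f x ^ 3 = 1) (h1 : f x ≠ 1) :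
    ∃ H : Subgroup M, S ≤ H ∧ Nat.card H = 3 * Nat.card S := by
  obtain ⟨y, hy, hyS⟩ := exists_orderOf_eq_three_normalized f hker S hS hSf x h3 h1
  have hcard : Nat.card (Subgroup.zpowers y) = 3 := by rw [Nat.card_zpowers, hy]
  have hle : S ≤ Subgroup.normalizer (Subgroup.zpowers y : Set M) := by
    intro s hs
    refine Subgroup.mem_normalizer_fintype ?_
    rintro z ⟨i, rfl⟩
    change s * y ^ i * s⁻¹ ∈ Subgroup.zpowers y
    rw [← conj_zpow]
    exact zpow_mem (hyS s hs) i
  refine ⟨Subgroup.zpowers y ⊔ S, le_sup_right, Nat.le_antisymm ?_ ?_⟩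
  · have h := Set.natCard_mul_le (s := (Subgroup.zpowers y : Set M)) (t := (S : Set M))
    rw [← Subgroup.coe_mul_of_right_le_normalizer_left _ _ hle] at h
    rw [← hcard]
    exact h
  · refine Nat.le_of_dvd Nat.card_pos (Nat.Coprime.mul_dvd_of_dvd_of_dvd ?_ ?_ ?_)
    · obtain ⟨k, hk⟩ := IsPGroup.iff_card.1 hS
      rw [hk]
      exact Nat.Coprime.pow_right k (by norm_num)
    · rw [← hcard]
      exact Subgroup.card_dvd_of_le le_sup_left
    · exact Subgroup.card_dvd_of_le le_sup_right

/-! ### The subgroup `H` from a Sylow property and an extension property -/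

theorem card_mul_relIndex {N : Type*} [Group N] {A B : Subgroup N} (h : A ≤ B) :
    Nat.card A * A.relIndex B = Nat.card B := by
  rw [← Subgroup.relIndex_bot_left, ← Subgroup.relIndex_bot_left]
  exact Subgroup.relIndex_mul_relIndex ⊥ A B bot_le h

theorem card_sup_of_coprime {N : Type*} [Group N] [Finite N] (D K : Subgroup N) [K.Normal]
    (h : (Nat.card D).Coprime (Nat.card K)) : Nat.card (D ⊔ K : Subgroup N) =
      Nat.card D * Nat.card K := by
  have h1 := card_mul_relIndex (le_sup_right : K ≤ D ⊔ K)
  rw [Subgroup.relIndex_sup_right, ← Subgroup.inf_relIndex_right, inf_comm,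
    (Subgroup.disjoint_of_coprime_natCard h).eq_bot, Subgroup.relIndex_bot_left] at h1
  rw [← h1, mul_comm]

/-- The group-theoretic core. Here `hsyl` is what remains of full automization, and `hext` of
receptivity. -/
theorem exists_sylow_two_power_index {N : Type*} [Group N] [Finite N] (C K T : Subgroup N)
    [K.Normal] (hKC : K ≤ C) (hK : (Nat.card K).Coprime 2)
    (hCK : ∀ z ∈ C, ∃ k : ℕ, z ^ 2 ^ k ∈ K) (hT : IsPGroup 2 T)
    (f : N →* Perm (Fin 3)) (hCf : C ≤ f.ker)
    (hfC : ∀ z, f z = 1 → ∃ k : ℕ, z ^ 2 ^ k ∈ C)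
    (hsyl : ∀ L : Subgroup N, L.Normal → (∀ z ∈ L, ∃ k : ℕ, z ^ 2 ^ k ∈ C) → L ≤ T ⊔ C)
    (hext : ∀ (g : N) (D : Subgroup N), D ≤ T → (∀ d ∈ D, g * d * g⁻¹ ∈ T ⊔ C) →
      ∃ h : N, h⁻¹ * g ∈ C ∧ ∀ d ∈ D, h * d * h⁻¹ ∈ T)
    (x : N) (h3 : f x ^ 3 = 1) (h1 : f x ≠ 1) :
    ∃ H : Subgroup N, T ≤ H ∧ ¬ 2 ∣ T.relIndex H ∧ ∃ k : ℕ, H.index = 2 ^ k := by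
  have hfK : ∀ z, f z = 1 → ∃ k : ℕ, z ^ 2 ^ k ∈ K := by
    intro z hz
    obtain ⟨i, hi⟩ := hfC z hz
    obtain ⟨j, hj⟩ := hCK _ hi
    exact ⟨i + j, by rwa [pow_add, pow_mul]⟩
  have hL : f.ker ≤ T ⊔ C := hsyl _ inferInstance fun z hz => hfC z hz
  have hKf : K ≤ f.ker := hKC.trans hCf
  set D := T ⊓ f.ker with hD
  set E := D ⊔ K with hE
  have hEf : E ≤ f.ker := sup_le inf_le_right hKf
  -- The kernel of `f` is normal and lies in `TC`, so `x` conjugates `D` into `TC`. As `h` differs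
  -- from `x` by an element of `C`, it has the same image in `S_3`.
  obtain ⟨h, hhx, hhD⟩ := hext x D inf_le_left fun d hd =>
    hL ((inferInstance : f.ker.Normal).conj_mem d hd.2 x)
  have hfh : f h = f x := by
    have := hCf hhx
    rw [MonoidHom.mem_ker, map_mul, map_inv] at this
    exact inv_mul_eq_one.1 this
  have hnorm : ∀ g : N, (∀ d ∈ D, g * d * g⁻¹ ∈ D) → g ∈ Subgroup.normalizer (E : Set N) := by
    intro g hg
    refine Subgroup.mem_normalizer_fintype fun z hz => ?_
    obtain ⟨d, hd, k, hk, rfl⟩ := Subgroup.mem_sup_of_normal_right.1 (show z ∈ D ⊔ K from hz)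
    have : g * (d * k) * g⁻¹ = (g * d * g⁻¹) * (g * k * g⁻¹) := by group
    rw [this]
    exact mul_mem (Subgroup.mem_sup_left (hg d hd))
      (Subgroup.mem_sup_right ((inferInstance : K.Normal).conj_mem k hk g))
  set M := Subgroup.normalizer (E : Set N) with hM
  have hEM : E ≤ M := Subgroup.le_normalizer
  have hTM : T ≤ M := fun t ht => hnorm t fun d hd =>
    ⟨mul_mem (mul_mem ht hd.1) (T.inv_mem ht), (inferInstance : f.ker.Normal).conj_mem d hd.2 t⟩
  have hhM : h ∈ M := hnorm h fun d hd =>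
    ⟨hhD d hd, (inferInstance : f.ker.Normal).conj_mem d hd.2 h⟩
  set E' : Subgroup M := E.subgroupOf M with hE'
  set T' : Subgroup M := T.subgroupOf M with hT'
  let q : M →* M ⧸ E' := QuotientGroup.mk' E'
  have hq : Function.Surjective q := QuotientGroup.mk'_surjective E'
  have hqk : q.ker = E' := QuotientGroup.ker_mk' E'
  let fbar : M ⧸ E' →* Perm (Fin 3) := QuotientGroup.lift E' (f.comp M.subtype) fun z hz => hEf hz
  have hfq : ∀ z : M, fbar (q z) = f z := fun z => rfl
  -- Hence the image of `T` modulo `E` is `T/D`, on which `fbar` is injective.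
  have hTE : T ⊓ E = D := le_antisymm (fun z hz => ⟨hz.1, hEf hz.2⟩)
    (le_inf inf_le_left le_sup_left)
  obtain ⟨Hbar, hTH, hcardH⟩ := exists_subgroup_card_eq_three_mul fbar (by
      intro z hz
      obtain ⟨z, rfl⟩ := hq z
      obtain ⟨k, hk⟩ := hfK z (by rwa [hfq] at hz)
      refine ⟨k, ?_⟩
      rw [← map_pow, ← MonoidHom.mem_ker, hqk]
      exact Subgroup.mem_sup_right hk) (T'.map q)
    ((hT.comap_of_injective M.subtype Subtype.val_injective).map q) (by
      rintro _ ⟨t, ht, rfl⟩ hft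
      rw [hfq] at hft
      rw [← MonoidHom.mem_ker, hqk]
      exact Subgroup.mem_sup_left ⟨ht, hft⟩) (q ⟨h, hhM⟩)
    (by rw [hfq]; simpa [hfh] using h3) (by rw [hfq]; simpa [hfh] using h1)
  set H : Subgroup N := (Hbar.comap q).map M.subtype with hH
  have hTH' : T ≤ H := by
    intro t ht
    exact ⟨⟨t, hTM ht⟩, hTH ⟨⟨t, hTM ht⟩, ht, rfl⟩, rfl⟩
  have hcardS : Nat.card (T'.map q) * Nat.card D = Nat.card T := by
    rw [← Subgroup.relIndex_ker, hqk, Subgroup.relIndex_subgroupOf hTM,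
      ← Subgroup.inf_relIndex_right, inf_comm, hTE, mul_comm]
    exact card_mul_relIndex (inf_le_left : D ≤ T)
  have hcop : (Nat.card D).Coprime (Nat.card K) := by
    obtain ⟨k, hk⟩ := IsPGroup.iff_card.1 (hT.to_le (inf_le_left : D ≤ T))
    rw [hk]
    exact Nat.Coprime.pow_left k hK.symm
  have hcH : Nat.card H = Nat.card Hbar * Nat.card E := by
    have e1 := Subgroup.card_mul_index (Hbar.comap q)
    rw [Subgroup.index_comap_of_surjective _ hq] at e1
    have e2 := Subgroup.card_mul_index Hbar
    have e3 := Subgroup.card_mul_index E'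
    rw [Subgroup.index_eq_card] at e3
    have e4 : Nat.card E' = Nat.card E := Nat.card_congr (Subgroup.subgroupOfEquivOfLe hEM).toEquiv
    have e5 : Nat.card H = Nat.card (Hbar.comap q) :=
      Subgroup.card_map_of_injective Subtype.val_injective
    rw [e5]
    refine Nat.eq_of_mul_eq_mul_right (Nat.pos_of_ne_zero Hbar.index_ne_zero_of_finite) ?_
    rw [e1, ← e3, e4, ← e2]
    ring
  have hcH' : Nat.card H = Nat.card T * (3 * Nat.card K) := by
    have hcE : Nat.card E = Nat.card D * Nat.card K := card_sup_of_coprime D K hcop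
    rw [hcH, hcardH, hcE, ← hcardS]
    ring
  refine ⟨H, hTH', ?_, ?_⟩
  · have h2 := card_mul_relIndex hTH'
    rw [hcH'] at h2
    rw [Nat.eq_of_mul_eq_mul_left Nat.card_pos h2, Nat.Prime.dvd_mul Nat.prime_two]
    rintro (h | h)
    · omega
    · have := Nat.dvd_gcd h (dvd_refl 2)
      rw [hK] at this
      omega
  · have hKH : K ≤ H := by
      intro k hk
      have hkM : k ∈ M := hEM (Subgroup.mem_sup_right hk)
      refine ⟨⟨k, hkM⟩, ?_, rfl⟩
      have : q ⟨k, hkM⟩ = 1 := by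
        rw [← MonoidHom.mem_ker, hqk]
        exact Subgroup.mem_sup_right hk
      change q ⟨k, hkM⟩ ∈ Hbar
      rw [this]
      exact one_mem _
    have hrel : K.relIndex H = 3 * Nat.card T := by
      have h2 := card_mul_relIndex hKH
      rw [hcH'] at h2
      refine Nat.eq_of_mul_eq_mul_left (Nat.card_pos (α := K)) ?_
      rw [h2]
      ring
    have hLK : ∃ k : ℕ, K.relIndex f.ker = 2 ^ k := by
      have : IsPGroup 2 (f.ker ⧸ K.subgroupOf f.ker) := by
        intro z
        obtain ⟨z, rfl⟩ := QuotientGroup.mk_surjective z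
        obtain ⟨k, hk⟩ := hfK z z.2
        refine ⟨k, ?_⟩
        rw [← QuotientGroup.mk_pow, QuotientGroup.eq_one_iff]
        exact hk
      exact IsPGroup.iff_card.1 this
    obtain ⟨k, hk⟩ := hLK
    -- Since `|S_3| = 6`, the prime 3 divides `|N : K|` at most once; `|H : K| = 3|T|` absorbs it.
    have hind : K.index ∣ 3 * 2 ^ (k + 1) := by
      rw [← Subgroup.relIndex_mul_index hKf, hk, Subgroup.index_ker, pow_succ]
      have h6 : Nat.card f.range ∣ 6 := by
        have := Subgroup.card_subgroup_dvd_card f.range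
        rwa [Nat.card_perm, Nat.card_fin] at this
      calc 2 ^ k * Nat.card f.range ∣ 2 ^ k * 6 := mul_dvd_mul_left _ h6
        _ = 3 * (2 ^ k * 2) := by ring
    rw [← Subgroup.relIndex_mul_index hKH, hrel, mul_assoc] at hind
    have := (Nat.mul_dvd_mul_iff_left (by norm_num)).1 hind
    obtain ⟨j, -, hj⟩ := (Nat.dvd_prime_pow Nat.prime_two).1 ((dvd_mul_left _ _).trans this)
    exact ⟨j, hj⟩

/-! ### Homomorphisms from `Aut(X)` to `S_3` with 2-power kernel -/

/-- The automorphisms of a group permute each invariant set of at most three elements. -/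
theorem exists_perm_hom_of_card_le_three {X : Type*} [Group X] [Finite X] (p : X → Prop)
    (hp : ∀ (α : MulAut X) x, p x → p (α x)) (hcard : Nat.card {x // p x} ≤ 3) :
    ∃ F : MulAut X →* Perm (Fin 3), ∀ α, F α = 1 → ∀ x, p x → α x = x := by
  let Ω : SubMulAction (MulAut X) X := ⟨{x | p x}, fun α x hx => hp α x hx⟩
  have hΩ : Nat.card Ω ≤ 3 := hcard
  let ι : Ω ↪ Fin 3 := (Finite.equivFin Ω).toEmbedding.trans (Fin.castLEEmb hΩ)
  refine ⟨(Equiv.Perm.viaEmbeddingHom ι).comp (MulAction.toPermHom (MulAut X) Ω),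
    fun α hα x hx => ?_⟩
  have h := Equiv.Perm.viaEmbeddingHom_injective ι (hα.trans (map_one _).symm)
  exact congrArg Subtype.val (congrFun (congrArg DFunLike.coe h) (⟨x, hx⟩ : Ω))

theorem pow_apply_mem {X : Type*} [Group X] (Z : Subgroup X) (α : MulAut X)
    (hα : ∀ x ∈ Z, α x ∈ Z) (i : ℕ) : ∀ x ∈ Z, (α ^ i) x ∈ Z := by
  induction i with
  | zero => exact fun x hx => hx
  | succ i ih =>
    intro x hx
    rw [pow_succ]
    exact ih _ (hα x hx)

theorem pow_apply_eq_self {X : Type*} [Group X] {α : MulAut X} {x : X} (h : α x = x) (i : ℕ) :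
    (α ^ i) x = x := by
  induction i with
  | zero => rfl
  | succ i ih =>
    rw [pow_succ]
    exact (congrArg (α ^ i) h).trans ih

/-- An automorphism which fixes the involutions of an invariant abelian subgroup has a power of
two that fixes all the elements of given exponent. -/
theorem two_pow_apply_eq_self {X : Type*} [Group X] (Z : Subgroup X)
    (hZ : ∀ x ∈ Z, ∀ y ∈ Z, x * y = y * x) (α : MulAut X) (hα : ∀ x ∈ Z, α x ∈ Z)
    (hfix : ∀ z ∈ Z, z ^ 2 = 1 → α z = z) (i : ℕ) :
    ∀ x ∈ Z, x ^ 2 ^ (i + 1) = 1 → (α ^ 2 ^ i) x = x := by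
  induction i with
  | zero => simpa using hfix
  | succ i ih =>
    intro x hx hx1
    set β := α ^ 2 ^ i with hβ
    have hβx : β x ∈ Z := pow_apply_mem Z α hα _ x hx
    -- By induction `β` fixes `x ^ 2`, so `z = x⁻¹ * β x` squares to 1 and is fixed by `β`. Then `β
    -- (β x) = x * z ^ 2 = x`.
    have hsq : β x ^ 2 = x ^ 2 := by
      rw [← map_pow]
      exact ih _ (pow_mem hx 2) (by rw [← pow_mul, ← pow_succ', hx1])
    have hz : x⁻¹ * β x ∈ Z := mul_mem (inv_mem hx) hβx
    have hz2 : (x⁻¹ * β x) ^ 2 = 1 := by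
      rw [(show Commute x⁻¹ (β x) from hZ _ (inv_mem hx) _ hβx).mul_pow, hsq, inv_pow,
        inv_mul_cancel]
    have hβz : β (x⁻¹ * β x) = x⁻¹ * β x := pow_apply_eq_self (hfix _ hz hz2) _
    rw [pow_succ, pow_mul, ← hβ, sq]
    change β (β x) = x
    rw [map_mul, map_inv] at hβz
    have h1 : β (β x) = β x * (x⁻¹ * β x) := by rw [← hβz]; group
    rw [h1, ← mul_assoc, hZ _ (mul_mem hβx (inv_mem hx)) _ hβx, ← mul_assoc, ← sq, hsq]
    group

/-- A first power of two, `β`, of `α` fixes `Z` pointwise. Since `β x = x * z` with `z ∈ Z`,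
iterating gives `x * z ^ j`, so a further power of two kills `β`. -/
theorem exists_two_pow_eq_one {X : Type*} [Group X] [Finite X] (hX : IsPGroup 2 X)
    (Z : Subgroup X) (hZ : ∀ x ∈ Z, ∀ y ∈ Z, x * y = y * x) (α : MulAut X)
    (hα : ∀ x ∈ Z, α x ∈ Z) (hfix : ∀ z ∈ Z, z ^ 2 = 1 → α z = z)
    (hquot : ∀ x, x⁻¹ * α x ∈ Z) : ∃ k : ℕ, α ^ 2 ^ k = 1 := by
  obtain ⟨e, he⟩ := IsPGroup.iff_card.1 hX
  have hexp : ∀ x : X, x ^ 2 ^ e = 1 := fun x => by rw [← he]; exact pow_card_eq_one'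
  have hquot' : ∀ (i : ℕ) x, x⁻¹ * (α ^ i) x ∈ Z := by
    intro i
    induction i with
    | zero => intro x; simp
    | succ i ih =>
      intro x
      have : x⁻¹ * (α ^ (i + 1)) x = (x⁻¹ * α x) * ((α x)⁻¹ * (α ^ i) (α x)) := by
        rw [pow_succ, MulAut.mul_apply]
        group
      rw [this]
      exact mul_mem (hquot x) (ih _)
  refine ⟨e + e, ?_⟩
  rw [pow_add, pow_mul]
  set β := α ^ 2 ^ e with hβ
  ext x
  have hβz : β (x⁻¹ * β x) = x⁻¹ * β x :=
    two_pow_apply_eq_self Z hZ α hα hfix e _ (hquot' _ x) (by rw [pow_succ, pow_mul, hexp, one_pow])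
  have hpow : ∀ j : ℕ, (β ^ j) x = x * (x⁻¹ * β x) ^ j := by
    intro j
    induction j with
    | zero => simp
    | succ j ih =>
      rw [pow_succ', MulAut.mul_apply, ih, map_mul, map_pow, hβz, pow_succ', mul_assoc, mul_inv_cancel_left]
  rw [hpow, hexp, mul_one, MulAut.one_apply]

theorem exists_perm_hom_of_involutions {X : Type*} [Group X] [Finite X] (hX : IsPGroup 2 X)
    (hcomm : ∀ x y : X, x * y = y * x) (hcard : Nat.card {x : X // x ^ 2 = 1 ∧ x ≠ 1} ≤ 3) :
    ∃ F : MulAut X →* Perm (Fin 3), ∀ α, F α = 1 → ∃ k : ℕ, α ^ 2 ^ k = 1 := by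
  obtain ⟨F, hF⟩ := exists_perm_hom_of_card_le_three (fun x : X => x ^ 2 = 1 ∧ x ≠ 1)
    (fun α x hx => ⟨by rw [← map_pow, hx.1, map_one],
      fun h => hx.2 (α.injective (h.trans (map_one α).symm))⟩) hcard
  refine ⟨F, fun α hα => exists_two_pow_eq_one hX ⊤ (fun x _ y _ => hcomm x y) α
    (fun _ _ => Subgroup.mem_top _) (fun z _ hz => ?_) fun _ => Subgroup.mem_top _⟩
  by_cases h1 : z = 1
  · rw [h1, map_one]
  · exact hF α hα z ⟨hz, h1⟩

theorem apply_mem_center {X : Type*} [Group X] (α : MulAut X) {x : X}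
    (hx : x ∈ Subgroup.center X) : α x ∈ Subgroup.center X := by
  rw [Subgroup.mem_center_iff] at hx ⊢
  intro g
  obtain ⟨g, rfl⟩ := α.surjective g
  rw [← map_mul, ← map_mul, hx g]

theorem map_center_eq {X : Type*} [Group X] (α : MulAut X) :
    (Subgroup.center X).map (α : X →* X) = Subgroup.center X := by
  refine le_antisymm ?_ fun x hx => ⟨α⁻¹ x, apply_mem_center _ hx, MulAut.apply_inv_self X α x⟩
  rintro _ ⟨x, hx, rfl⟩
  exact apply_mem_center α hx

/-- Act on the at most three nontrivial cosets of the centre. An automorphism trivial on this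
quotient also fixes the only possible central involution, so the criterion above applies with `Z`
the centre. -/
theorem exists_perm_hom_of_center {X : Type*} [Group X] [Finite X] (hX : IsPGroup 2 X)
    (hcard : Nat.card (X ⧸ Subgroup.center X) ≤ 4)
    (huniq : ∀ z ∈ Subgroup.center X, ∀ w ∈ Subgroup.center X, z ^ 2 = 1 → w ^ 2 = 1 →
      z ≠ 1 → w ≠ 1 → z = w) :
    ∃ F : MulAut X →* Perm (Fin 3), ∀ α, F α = 1 → ∃ k : ℕ, α ^ 2 ^ k = 1 := by
  let V := X ⧸ Subgroup.center X
  let R : MulAut X →* MulAut V := MonoidHom.mk'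
    (fun α => QuotientGroup.congr _ _ α (map_center_eq α)) fun α β => by
      ext v
      obtain ⟨v, rfl⟩ := QuotientGroup.mk_surjective v
      rfl
  have hne : Nat.card {v : V // v ≠ 1} ≤ 3 := by
    have h := Set.ncard_add_ncard_compl ({1} : Set V)
    rw [Set.ncard_singleton] at h
    have h2 : Nat.card {v : V // v ≠ 1} = ({1}ᶜ : Set V).ncard := rfl
    have h3 : Nat.card V ≤ 4 := hcard
    omega
  obtain ⟨F, hF⟩ := exists_perm_hom_of_card_le_three (fun v : V => v ≠ 1)
    (fun α x hx h => hx (α.injective (h.trans (map_one α).symm))) hne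
  refine ⟨F.comp R, fun α hα => exists_two_pow_eq_one hX (Subgroup.center X)
    (fun x hx y _ => (Subgroup.mem_center_iff.1 hx y).symm) α (fun x hx => apply_mem_center α hx)
    (fun z hz hz2 => ?_) fun x => ?_⟩
  · by_cases h1 : z = 1
    · rw [h1, map_one]
    · exact huniq _ (apply_mem_center α hz) _ hz (by rw [← map_pow, hz2, map_one]) hz2
        (fun h => h1 (α.injective (h.trans (map_one α).symm))) h1
  · have h : R α (x : V) = (x : V) := by
      by_cases h1 : (x : V) = 1
      · rw [h1, map_one]
      · exact hF _ hα _ h1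
    exact QuotientGroup.eq.1 h.symm

/-! ### Involutions, commutators and centre of the wreath product -/

section Wreathed

variable {n : ℕ}

instance : Finite (Wreathed n) := by
  unfold Wreathed
  infer_instance

theorem isPGroup_wreathed : IsPGroup 2 (Wreathed n) := by
  refine IsPGroup.iff_card.2 ⟨n * 2 + 1, ?_⟩
  rw [RegularWreathProduct.card, Nat.card_eq_of_bijective Multiplicative.toAdd
    Multiplicative.toAdd.bijective, Nat.card_eq_of_bijective
      (Multiplicative.toAdd (α := ZMod 2)) Multiplicative.toAdd.bijective, Nat.card_zmod,
    Nat.card_zmod, pow_succ 2 (n * 2), pow_mul]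

theorem eq_one_or_eq_ofAdd_one :
    ∀ q : Multiplicative (ZMod 2), q = 1 ∨ q = Multiplicative.ofAdd 1 := by decide

theorem ncard_sq_eq_one_le :
    {d : Multiplicative (ZMod (2 ^ n)) | d ^ 2 = 1}.ncard ≤ 2 := by
  classical
  have := Fintype.ofFinite (Multiplicative (ZMod (2 ^ n)))
  have h := IsCyclic.card_pow_eq_one_le (α := Multiplicative (ZMod (2 ^ n))) (n := 2) (by norm_num)
  rw [← Set.ncard_coe_finset] at h
  simpa using h

theorem eq_of_sq_eq_one {d d' : Multiplicative (ZMod (2 ^ n))} (h : d ^ 2 = 1) (h' : d' ^ 2 = 1)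
    (h1 : d ≠ 1) (h1' : d' ≠ 1) : d = d' := by
  by_contra hne
  have h3 : ({1, d, d'} : Set (Multiplicative (ZMod (2 ^ n)))).ncard = 3 :=
    Set.ncard_eq_three.2 ⟨1, d, d', h1.symm, h1'.symm, hne, rfl⟩
  have hle : ({1, d, d'} : Set (Multiplicative (ZMod (2 ^ n)))).ncard ≤ _ :=
    Set.ncard_le_ncard (t := {d : Multiplicative (ZMod (2 ^ n)) | d ^ 2 = 1}) (by
      rintro x (rfl | rfl | rfl)
      · exact one_pow 2
      · exact h
      · exact h') (Set.toFinite _)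
  have := ncard_sq_eq_one_le (n := n)
  omega

theorem wreathed_left_ext {f g : Multiplicative (ZMod 2) → Multiplicative (ZMod (2 ^ n))}
    (h0 : f 1 = g 1) (h1 : f (Multiplicative.ofAdd 1) = g (Multiplicative.ofAdd 1)) : f = g := by
  funext q
  rcases eq_one_or_eq_ofAdd_one q with rfl | rfl
  · exact h0
  · exact h1

theorem wreathed_commute {x y : Wreathed n} (hx : x.right = 1) (hy : y.right = 1) :
    x * y = y * x := by
  ext q
  · simp [hx, hy, mul_comm]
  · simp [hx, hy]

theorem wreathed_sq_left {x : Wreathed n} (hx : x.right = 1) (h2 : x ^ 2 = 1)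
    (q : Multiplicative (ZMod 2)) : x.left q ^ 2 = 1 := by
  have h := congrFun (congrArg RegularWreathProduct.left h2) q
  rw [sq] at h ⊢
  simpa [hx] using h

theorem ncard_wreathed_base_involutions :
    {x : Wreathed n | x.right = 1 ∧ x ^ 2 = 1 ∧ x ≠ 1}.ncard ≤ 3 := by
  let A := {d : Multiplicative (ZMod (2 ^ n)) | d ^ 2 = 1}
  let S := {x : Wreathed n | x.right = 1 ∧ x ^ 2 = 1}
  have hS : S.ncard ≤ 4 := by
    have hle : S.ncard ≤ (A ×ˢ A).ncard := by
      refine Set.ncard_le_ncard_of_injOn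
        (fun x => (x.left 1, x.left (Multiplicative.ofAdd 1)))
        (fun x hx => ⟨wreathed_sq_left hx.1 hx.2 _, wreathed_sq_left hx.1 hx.2 _⟩) ?_
        (Set.toFinite _)
      intro x hx y hy hxy
      exact RegularWreathProduct.ext (wreathed_left_ext (congrArg Prod.fst hxy)
        (congrArg Prod.snd hxy)) (hx.1.trans hy.1.symm)
    rw [Set.ncard_prod] at hle
    exact hle.trans (Nat.mul_le_mul ncard_sq_eq_one_le ncard_sq_eq_one_le)
  have h1 : (1 : Wreathed n) ∈ S := ⟨rfl, one_pow 2⟩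
  have h := Set.ncard_sdiff_singleton_of_mem h1
  have hd : {x : Wreathed n | x.right = 1 ∧ x ^ 2 = 1 ∧ x ≠ 1} = S \ {1} := by
    ext x
    simp [S, and_assoc]
  rw [hd, h]
  omega

/-- The product of the two base coordinates. -/
def baseProd (n : ℕ) : Wreathed n →* Multiplicative (ZMod (2 ^ n)) :=
  MonoidHom.mk' (fun x => x.left 1 * x.left (Multiplicative.ofAdd 1)) fun x y => by
    have h2 : (Multiplicative.ofAdd (1 : ZMod 2))⁻¹ = Multiplicative.ofAdd 1 := by decide
    have h3 : Multiplicative.ofAdd (1 : ZMod 2) * Multiplicative.ofAdd 1 = 1 := by decide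
    rcases eq_one_or_eq_ofAdd_one x.right with h | h
    · simp only [RegularWreathProduct.mul_left, Pi.mul_apply, h, inv_one, one_mul]
      exact mul_mul_mul_comm _ _ _ _
    · simp only [RegularWreathProduct.mul_left, Pi.mul_apply, h, h2, h3, mul_one]
      rw [mul_mul_mul_comm, mul_comm (y.left (Multiplicative.ofAdd 1))]

/-- A commutator lies in the base group, and its coordinates have product 1 because `baseProd` has
abelian target. If it squares to 1, each coordinate is its own inverse, so the two agree; diagonal
elements are central. -/
theorem wreathed_commutator_central (u v w : Wreathed n) (h : (u * v * u⁻¹ * v⁻¹) ^ 2 = 1) :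
    (u * v * u⁻¹ * v⁻¹) * w = w * (u * v * u⁻¹ * v⁻¹) := by
  set c := u * v * u⁻¹ * v⁻¹ with hc
  have hr : c.right = 1 := by
    simp only [hc, RegularWreathProduct.mul_right, RegularWreathProduct.inv_right]
    rw [mul_comm u.right]
    group
  have hb : c.left 1 * c.left (Multiplicative.ofAdd 1) = 1 := by
    change baseProd n c = 1
    rw [hc, map_mul, map_mul, map_mul, map_inv, map_inv, mul_comm (baseProd n u)]
    group
  have heq : c.left (Multiplicative.ofAdd 1) = c.left 1 := by
    have h2 := wreathed_sq_left hr h 1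
    rw [sq] at h2
    exact mul_left_cancel (hb.trans h2.symm)
  have hconst : ∀ q, c.left q = c.left 1 := by
    intro q
    rcases eq_one_or_eq_ofAdd_one q with rfl | rfl
    · rfl
    · exact heq
  ext q
  · simp only [RegularWreathProduct.mul_left, Pi.mul_apply, hr, hconst (w.right⁻¹ * q), hconst q,
      inv_one, one_mul]
    rw [mul_comm]
  · simp [hr]

theorem wreathed_center (hn : n ≠ 0) {z : Wreathed n} (hz : ∀ w, z * w = w * z) :
    z.right = 1 ∧ z.left (Multiplicative.ofAdd 1) = z.left 1 := by
  have h2 : (Multiplicative.ofAdd (1 : ZMod 2))⁻¹ = Multiplicative.ofAdd 1 := by decide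
  constructor
  · refine (eq_one_or_eq_ofAdd_one z.right).resolve_right fun h => ?_
    have hA := congrFun (congrArg RegularWreathProduct.left (hz (wrA n))) 1
    simp only [RegularWreathProduct.mul_left, Pi.mul_apply, h, h2, mul_one] at hA
    rw [mul_comm, show (wrA n).right⁻¹ = 1 from inv_one] at hA
    have hA2 := mul_right_cancel (b := z.left 1) hA
    have hl : (wrA n).left 1 = Multiplicative.ofAdd 1 :=
      Pi.mulSingle_eq_same (M := fun _ : Multiplicative (ZMod 2) => Multiplicative (ZMod (2 ^ n)))
        (Multiplicative.ofAdd 0) (Multiplicative.ofAdd 1)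
    have hl2 : (wrA n).left (Multiplicative.ofAdd 1) = 1 :=
      Pi.mulSingle_eq_of_ne
        (M := fun _ : Multiplicative (ZMod 2) => Multiplicative (ZMod (2 ^ n)))
        (i := Multiplicative.ofAdd 0) (i' := Multiplicative.ofAdd 1) (by decide)
        (Multiplicative.ofAdd 1)
    rw [hl, hl2] at hA2
    have hA3 : (0 : ZMod (2 ^ n)) = 1 := congrArg Multiplicative.toAdd hA2
    have : Fact (1 < 2 ^ n) := ⟨Nat.one_lt_two_pow hn⟩
    exact zero_ne_one hA3
  · have hT := congrFun (congrArg RegularWreathProduct.left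
      (hz ⟨1, Multiplicative.ofAdd 1⟩)) 1
    simpa [h2] using hT.symm

/-- The centre lies in the diagonal, a cyclic group, which has at most one involution. -/
theorem wreathed_center_involution (hn : n ≠ 0) {z w : Wreathed n} (hz : ∀ x, z * x = x * z)
    (hw : ∀ x, w * x = x * w) (hz2 : z ^ 2 = 1) (hw2 : w ^ 2 = 1) (hz1 : z ≠ 1) (hw1 : w ≠ 1) :
    z = w := by
  obtain ⟨hzr, hzl⟩ := wreathed_center hn hz
  obtain ⟨hwr, hwl⟩ := wreathed_center hn hw
  have key : ∀ {x : Wreathed n}, x.right = 1 → x.left (Multiplicative.ofAdd 1) = x.left 1 →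
      x ≠ 1 → x.left 1 ≠ 1 := fun hr hl h1 h => h1
    (RegularWreathProduct.ext (wreathed_left_ext h (hl.trans h)) hr)
  have h0 := eq_of_sq_eq_one (wreathed_sq_left hzr hz2 1) (wreathed_sq_left hwr hw2 1)
    (key hzr hzl hz1) (key hwr hwl hw1)
  exact RegularWreathProduct.ext (wreathed_left_ext h0 (hzl.trans (h0.trans hwl.symm)))
    (hzr.trans hwr.symm)

end Wreathed

/-! ### The listed subgroups `Q` -/

section Listed

variable {G : Type*} [Group G] {P : Subgroup G} {n : ℕ}

theorem isPGroup_of_mulEquiv_wreathed (e : P ≃* Wreathed n) : IsPGroup 2 P :=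
  isPGroup_wreathed.of_equiv e.symm

theorem commutator_central (e : P ≃* Wreathed n) {u v p : G} (hu : u ∈ P) (hv : v ∈ P)
    (hp : p ∈ P) (h : (u * v * u⁻¹ * v⁻¹) ^ 2 = 1) :
    (u * v * u⁻¹ * v⁻¹) * p = p * (u * v * u⁻¹ * v⁻¹) := by
  let u' : P := ⟨u, hu⟩
  let v' : P := ⟨v, hv⟩
  let p' : P := ⟨p, hp⟩
  have h' : (u' * v' * u'⁻¹ * v'⁻¹) ^ 2 = 1 := Subtype.ext h
  have key := wreathed_commutator_central (e u') (e v') (e p') (by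
    rw [← map_inv, ← map_inv, ← map_mul, ← map_mul, ← map_mul, ← map_pow, h', map_one])
  rw [← map_inv, ← map_inv, ← map_mul, ← map_mul, ← map_mul, ← map_mul, ← map_mul] at key
  exact congrArg Subtype.val (e.injective key)

theorem center_involution_unique (hn : n ≠ 0) (e : P ≃* Wreathed n) {z w : G} (hzP : z ∈ P)
    (hwP : w ∈ P) (hz : ∀ p ∈ P, z * p = p * z) (hw : ∀ p ∈ P, w * p = p * w)
    (hz2 : z ^ 2 = 1) (hw2 : w ^ 2 = 1) (hz1 : z ≠ 1) (hw1 : w ≠ 1) : z = w := by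
  have key : ∀ {x : G} (hx : x ∈ P), (∀ p ∈ P, x * p = p * x) → x ^ 2 = 1 → x ≠ 1 →
      (∀ q, e ⟨x, hx⟩ * q = q * e ⟨x, hx⟩) ∧ e ⟨x, hx⟩ ^ 2 = 1 ∧ e ⟨x, hx⟩ ≠ 1 := by
    intro x hx hc h2 h1
    refine ⟨fun q => ?_, ?_, fun h => h1 ?_⟩
    · obtain ⟨q, rfl⟩ := e.surjective q
      rw [← map_mul, ← map_mul]
      exact congrArg e (Subtype.ext (hc q q.2))
    · rw [← map_pow, ← map_one e]
      exact congrArg e (Subtype.ext h2)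
    · exact congrArg Subtype.val (e.injective (h.trans (map_one e).symm))
  obtain ⟨z1, z2, z3⟩ := key hzP hz hz2 hz1
  obtain ⟨w1, w2, w3⟩ := key hwP hw hw2 hw1
  exact congrArg Subtype.val (e.injective (wreathed_center_involution hn z1 w1 z2 w2 z3 w3))

theorem exists_perm_hom_of_homocyclic [Finite G] (e : P ≃* Wreathed n) (m : ℕ) :
    ∃ F : MulAut (homocyclic e m) →* Perm (Fin 3), ∀ α, F α = 1 → ∃ k : ℕ, α ^ 2 ^ k = 1 := by
  have hbase : ∀ x : homocyclic e m, ∃ hx : (x : G) ∈ P, (e ⟨x, hx⟩).right = 1 := by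
    rintro ⟨_, w, hw, rfl⟩
    have hle : Subgroup.zpowers (wrA n ^ 2 ^ m) ⊔ Subgroup.zpowers (wrB n ^ 2 ^ m) ≤
        (RegularWreathProduct.rightHom : Wreathed n →* Multiplicative (ZMod 2)).ker := by
      refine sup_le ?_ ?_ <;>
      · rw [Subgroup.zpowers_le]
        refine pow_mem ?_ _
        rfl
    refine ⟨(e.symm w).2, ?_⟩
    change (e (e.symm w)).right = 1
    rw [MulEquiv.apply_symm_apply]
    exact hle hw
  choose hP hright using hbase
  have hinj : Function.Injective fun x : homocyclic e m => e ⟨x, hP x⟩ := fun x y hxy =>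
    Subtype.ext (Subtype.mk.inj (e.injective hxy))
  have hmul : ∀ x y : homocyclic e m, e ⟨(x * y : homocyclic e m), hP _⟩ =
      e ⟨x, hP x⟩ * e ⟨y, hP y⟩ := fun x y => map_mul e ⟨x, hP x⟩ ⟨y, hP y⟩
  have hone : e ⟨(1 : homocyclic e m), hP _⟩ = 1 := map_one e
  refine exists_perm_hom_of_involutions ?_ ?_ ?_
  · exact (isPGroup_of_mulEquiv_wreathed e).to_le fun x hx => hP ⟨x, hx⟩
  · intro x y
    apply hinj
    simp only [hmul]
    exact wreathed_commute (hright x) (hright y)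
  · refine le_trans ?_ (ncard_wreathed_base_involutions (n := n))
    refine Nat.card_le_card_of_injective (β := {x : Wreathed n | x.right = 1 ∧ x ^ 2 = 1 ∧ x ≠ 1})
      (fun x => ⟨e ⟨x.1, hP x.1⟩, hright x.1, ?_, fun h => x.2.2 (hinj (h.trans hone.symm))⟩) ?_
    · rw [sq, ← hmul, ← hone]
      have := x.2.1
      rw [sq] at this
      exact congrArg (fun x : homocyclic e m => e ⟨x, hP x⟩) this
    · intro x y hxy
      exact Subtype.ext (hinj (congrArg Subtype.val hxy))

theorem quaternion_center : ∀ g : QuaternionGroup 2, (∀ h, g * h = h * g) →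
    g = 1 ∨ g = QuaternionGroup.a 2 := by decide

/-- The involution `c` of `Z(Y)` is a commutator, hence central in `P`. It follows that `Z(Q) ≤
Z(P)`, which leaves at most one central involution, and that `Q/Z(Q)` is a quotient of `Y/⟨c⟩`, of
order 4. -/
theorem exists_perm_hom_of_isQuaternionCentralProduct [Finite G] (hn : n ≠ 0)
    (e : P ≃* Wreathed n) (Q : Subgroup G) (m : ℕ) (hQ : IsQuaternionCentralProduct P Q m) :
    ∃ F : MulAut Q →* Perm (Fin 3), ∀ α, F α = 1 → ∃ k : ℕ, α ^ 2 ^ k = 1 := by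
  obtain ⟨Y, K, hY, ⟨η⟩, hK, -, -, rfl⟩ := hQ
  have hKP : ∀ k ∈ K, k ∈ P ∧ ∀ p ∈ P, k * p = p * k := by
    intro k hk
    obtain ⟨k, hkc, rfl⟩ := hK hk
    exact ⟨k.2, fun p hp => (congrArg Subtype.val (Subgroup.mem_center_iff.1 hkc ⟨p, hp⟩)).symm⟩
  have hQP : Y ⊔ K ≤ P := sup_le hY fun k hk => (hKP k hk).1
  have hYK : ∀ x ∈ Y ⊔ K, ∃ y ∈ Y, ∃ k ∈ K, y * k = x := by
    intro x hx
    have hle : Y ≤ Subgroup.normalizer (K : Set G) := by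
      intro y hy
      refine Subgroup.mem_normalizer_fintype fun k hk => ?_
      rw [← (hKP k hk).2 y (hY hy), mul_inv_cancel_right]
      exact hk
    rw [← SetLike.mem_coe, Subgroup.coe_mul_of_left_le_normalizer_right _ _ hle] at hx
    obtain ⟨y, hy, k, hk, h⟩ := hx
    exact ⟨y, hy, k, hk, h⟩
  set c : Y := η.symm (QuaternionGroup.a 2) with hc
  have hc1 : c ≠ 1 := by
    rw [hc, Ne, MulEquiv.map_eq_one_iff]
    decide
  have hc2 : c ^ 2 = 1 := by
    rw [hc, ← map_pow, MulEquiv.map_eq_one_iff]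
    decide
  obtain ⟨u, v, huv⟩ : ∃ u v : Y, u * v * u⁻¹ * v⁻¹ = c := by
    refine ⟨η.symm (QuaternionGroup.a 1), η.symm (QuaternionGroup.xa 0), ?_⟩
    rw [← map_inv, ← map_inv, ← map_mul, ← map_mul, ← map_mul, hc]
    exact congrArg η.symm (by decide)
  have hcP : ∀ p ∈ P, (c : G) * p = p * c := by
    intro p hp
    have huv' : (u : G) * v * (u : G)⁻¹ * (v : G)⁻¹ = c := congrArg Subtype.val huv
    rw [← huv']
    refine commutator_central e (hY u.2) (hY v.2) hp ?_
    rw [huv']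
    exact congrArg Subtype.val hc2
  have hcenter : ∀ z : (Y ⊔ K : Subgroup G), z ∈ Subgroup.center (Y ⊔ K : Subgroup G) →
      ∀ p ∈ P, (z : G) * p = p * z := by
    intro z hz p hp
    obtain ⟨y, hy, k, hk, hyk⟩ := hYK z z.2
    have hyc : ∀ h, η ⟨y, hy⟩ * h = h * η ⟨y, hy⟩ := by
      intro h
      obtain ⟨h, rfl⟩ := η.surjective h
      rw [← map_mul, ← map_mul]
      refine congrArg η (Subtype.ext ?_)
      have h1 : (h : G) * z = z * h := congrArg Subtype.val
        (Subgroup.mem_center_iff.1 hz ⟨h, Subgroup.mem_sup_left h.2⟩)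
      rw [← hyk, mul_assoc, (hKP k hk).2 h (hY h.2), ← mul_assoc, ← mul_assoc] at h1
      exact (mul_right_cancel h1).symm
    have hyP : y * p = p * y := by
      rcases quaternion_center _ hyc with h | h
      · have : y = 1 := congrArg Subtype.val (η.injective (h.trans (map_one η).symm))
        rw [this, one_mul, mul_one]
      · have : (⟨y, hy⟩ : Y) = c := by rw [hc, ← h, MulEquiv.symm_apply_apply]
        have h2 : y = c := congrArg Subtype.val this
        rw [h2, hcP p hp]
    rw [← hyk, mul_assoc, (hKP k hk).2 p hp, ← mul_assoc, hyP, mul_assoc]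
  refine exists_perm_hom_of_center ((isPGroup_of_mulEquiv_wreathed e).to_le hQP) ?_ ?_
  · let π : Y →* (Y ⊔ K : Subgroup G) ⧸ Subgroup.center (Y ⊔ K : Subgroup G) :=
      (QuotientGroup.mk' _).comp (Subgroup.inclusion le_sup_left)
    have hπ : Function.Surjective π := by
      intro x
      obtain ⟨x, rfl⟩ := QuotientGroup.mk_surjective x
      obtain ⟨y, hy, k, hk, hyk⟩ := hYK x x.2
      refine ⟨⟨y, hy⟩, QuotientGroup.eq.2 ?_⟩
      have : (Subgroup.inclusion (le_sup_left : Y ≤ Y ⊔ K) ⟨y, hy⟩)⁻¹ * x =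
          ⟨k, Subgroup.mem_sup_right hk⟩ := Subtype.ext (by
        change y⁻¹ * (x : G) = k
        rw [← hyk, inv_mul_cancel_left])
      rw [this, Subgroup.mem_center_iff]
      exact fun g => Subtype.ext ((hKP k hk).2 g (hQP g.2)).symm
    have hker : c ∈ π.ker := by
      refine (QuotientGroup.eq_one_iff _).2 (Subgroup.mem_center_iff.2 fun g => Subtype.ext ?_)
      exact (hcP g (hQP g.2)).symm
    have h8 : Nat.card Y = 8 := by
      rw [Nat.card_congr η.toEquiv, Nat.card_eq_fintype_card, QuaternionGroup.card]
    have hcard := Subgroup.card_mul_index π.ker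
    rw [Subgroup.index_ker, MonoidHom.range_eq_top.2 hπ, Subgroup.card_top, h8] at hcard
    have h2 : 1 < Nat.card π.ker := by
      rw [Subgroup.one_lt_card_iff_ne_bot]
      exact fun h => hc1 (by rwa [h, Subgroup.mem_bot] at hker)
    nlinarith
  · intro z hz w hw hz2 hw2 hz1 hw1
    exact Subtype.ext (center_involution_unique hn e (hQP z.2) (hQP w.2) (hcenter z hz)
      (hcenter w hw) (congrArg Subtype.val hz2) (congrArg Subtype.val hw2)
      (fun h => hz1 (Subtype.ext h)) fun h => hw1 (Subtype.ext h))

theorem exists_perm_hom_of_isListed [Finite G] (hn : n ≠ 0) (e : P ≃* Wreathed n)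
    (Q : Subgroup G) (hQ : IsListed e Q) :
    ∃ F : MulAut Q →* Perm (Fin 3), ∀ α, F α = 1 → ∃ k : ℕ, α ^ 2 ^ k = 1 := by
  rcases hQ with ⟨m, -, rfl⟩ | ⟨m, -, -, hQ⟩
  · exact exists_perm_hom_of_homocyclic e m
  · exact exists_perm_hom_of_isQuaternionCentralProduct hn e Q m hQ

end Listed

/-! ### Consequences of saturation -/

section Fusion

variable {G : Type*} [Group G]

theorem inv_mul_mem_centralizer {R : Subgroup G} {u t : G}
    (h : ∀ x ∈ R, u * x * u⁻¹ = t * x * t⁻¹) : t⁻¹ * u ∈ Subgroup.centralizer (R : Set G) := by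
  rw [Subgroup.mem_centralizer_iff]
  intro x hx
  have := h x hx
  calc x * (t⁻¹ * u) = t⁻¹ * (t * x * t⁻¹) * u := by group
    _ = t⁻¹ * (u * x * u⁻¹) * u := by rw [this]
    _ = t⁻¹ * u * x := by group

theorem conj_mul_centralizer {R : Subgroup G} {t c x : G}
    (hc : c ∈ Subgroup.centralizer (R : Set G)) (hx : x ∈ R) :
    (t * c) * x * (t * c)⁻¹ = t * x * t⁻¹ := by
  have h : x * c = c * x := Subgroup.mem_centralizer_iff.1 hc x hx
  calc (t * c) * x * (t * c)⁻¹ = t * (c * x) * c⁻¹ * t⁻¹ := by group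
    _ = t * x * t⁻¹ := by rw [← h]; group

section Conjugation

variable {Q R : Subgroup G} {g : G}

theorem conj_mem_normalizer_iff (h : ∀ x, x ∈ Q ↔ g * x * g⁻¹ ∈ R) (y : G) :
    y ∈ Subgroup.normalizer (Q : Set G) ↔ g * y * g⁻¹ ∈ Subgroup.normalizer (R : Set G) := by
  rw [Subgroup.mem_normalizer_iff, Subgroup.mem_normalizer_iff]
  have e : ∀ x, g * (y * x * y⁻¹) * g⁻¹ = g * y * g⁻¹ * (g * x * g⁻¹) * (g * y * g⁻¹)⁻¹ :=
    fun x => by group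
  constructor
  · intro hy x
    have h1 := hy (g⁻¹ * x * g)
    rw [h, h, e] at h1
    have h2 : g * (g⁻¹ * x * g) * g⁻¹ = x := by group
    rwa [h2] at h1
  · intro hy x
    rw [h, h, e]
    exact hy _

theorem conj_mem_centralizer_iff (h : ∀ x, x ∈ Q ↔ g * x * g⁻¹ ∈ R) (y : G) :
    y ∈ Subgroup.centralizer (Q : Set G) ↔ g * y * g⁻¹ ∈ Subgroup.centralizer (R : Set G) := by
  rw [Subgroup.mem_centralizer_iff, Subgroup.mem_centralizer_iff]
  constructor
  · intro hy x hx
    have h2 : g * (g⁻¹ * x * g) * g⁻¹ = x := by group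
    have h1 := hy (g⁻¹ * x * g) ((h _).2 (by rw [h2]; exact hx))
    calc x * (g * y * g⁻¹) = g * ((g⁻¹ * x * g) * y) * g⁻¹ := by group
      _ = g * (y * (g⁻¹ * x * g)) * g⁻¹ := by rw [h1]
      _ = g * y * g⁻¹ * x := by group
  · intro hy x hx
    have h1 := hy (g * x * g⁻¹) ((h x).1 hx)
    calc x * y = g⁻¹ * ((g * x * g⁻¹) * (g * y * g⁻¹)) * g := by group
      _ = g⁻¹ * ((g * y * g⁻¹) * (g * x * g⁻¹)) * g := by rw [h1]
      _ = y * x := by group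

/-- Conjugation by `g` as an isomorphism onto a conjugate subgroup. -/
def conjEquiv (h : ∀ x, x ∈ Q ↔ g * x * g⁻¹ ∈ R) : Q ≃* R where
  toFun x := ⟨g * x * g⁻¹, (h x).1 x.2⟩
  invFun x := ⟨g⁻¹ * x * g, (h _).2 (by
    have h2 : g * (g⁻¹ * x * g) * g⁻¹ = x := by group
    rw [h2]
    exact x.2)⟩
  left_inv x := Subtype.ext (by
    change g⁻¹ * (g * x * g⁻¹) * g = x
    group)
  right_inv x := Subtype.ext (by
    change g * (g⁻¹ * x * g) * g⁻¹ = x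
    group)
  map_mul' x y := Subtype.ext (by
    change g * (x * y) * g⁻¹ = (g * x * g⁻¹) * (g * y * g⁻¹)
    group)

end Conjugation

/-- A subgroup which induces a `2`-group of automorphisms on a fully automized subgroup `R` is
conjugate in `N_G(R)` to a subgroup of `P C_G(R)`. -/
theorem FullyAutomized.exists_conj_le [Finite G] {P R : Subgroup G} (hR : FullyAutomized 2 P R)
    (X : Subgroup G) (hX : X ≤ Subgroup.normalizer (R : Set G))
    (hX2 : ∀ z ∈ X, ∃ k : ℕ, z ^ 2 ^ k ∈ Subgroup.centralizer (R : Set G)) :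
    ∃ w ∈ Subgroup.normalizer (R : Set G), ∀ z ∈ X, ∃ t ∈ P,
      ∃ c ∈ Subgroup.centralizer (R : Set G), w * z * w⁻¹ = t * c := by
  obtain ⟨-, S, hS⟩ := hR
  have hp : IsPGroup 2 (autBy X R) := by
    rintro ⟨_, z, hz, rfl⟩
    obtain ⟨k, hk⟩ := hX2 z hz
    refine ⟨k, Subtype.ext ?_⟩
    change R.normalizerMonoidHom z ^ 2 ^ k = 1
    rw [← map_pow, ← MonoidHom.mem_ker, Subgroup.normalizerMonoidHom_ker]
    exact hk
  obtain ⟨S2, hS2⟩ := (hp.comap_of_injective (autBy ⊤ R).subtype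
    Subtype.val_injective).exists_le_sylow
  obtain ⟨⟨_, ⟨w, hw⟩, hw', rfl⟩, ha⟩ := MulAction.exists_smul_eq (autBy ⊤ R) S2 S
  refine ⟨w, hw, fun z hz => ?_⟩
  let z' : Subgroup.normalizer (R : Set G) := ⟨z, hX hz⟩
  let b : autBy ⊤ R := ⟨R.normalizerMonoidHom z', z', Subgroup.mem_top _, rfl⟩
  let a : autBy ⊤ R := ⟨R.normalizerMonoidHom ⟨w, hw⟩, ⟨w, hw⟩, hw', rfl⟩
  have hb : b ∈ S2 := hS2 ⟨z', hz, rfl⟩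
  have hab : a * b * a⁻¹ ∈ (S : Subgroup (autBy ⊤ R)) := by
    rw [← ha]
    exact Subgroup.smul_mem_pointwise_smul b (MulAut.conj a) _ hb
  rw [hS] at hab
  obtain ⟨t, htP, ht⟩ := mem_autBy.1 hab
  refine ⟨t, htP, t⁻¹ * (w * z * w⁻¹), inv_mul_mem_centralizer fun x hx => ?_, by group⟩
  rw [← ht ⟨x, hx⟩]
  change w * z * w⁻¹ * x * (w * z * w⁻¹)⁻¹ =
    w * (z * (w⁻¹ * x * w⁻¹⁻¹) * z⁻¹) * w⁻¹
  group

/-- The condition on `D` says that each element of `D`, transported by `u`, acts on `R` as an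
element of `P`; this places `D` inside the extender. -/
theorem Receptive.exists_extension {P Q R : Subgroup G} (hR : Receptive P R) (hQP : Q ≤ P)
    (hRP : R ≤ P) {u : G} (hu : ∀ x, x ∈ Q ↔ u * x * u⁻¹ ∈ R) (D : Subgroup G) (hDP : D ≤ P)
    (hDQ : D ≤ Subgroup.normalizer (Q : Set G))
    (hD : ∀ d ∈ D, ∃ t ∈ P, ∃ c ∈ Subgroup.centralizer (R : Set G), u * d * u⁻¹ = t * c) :
    ∃ h : G, (∀ x ∈ Q, h * x * h⁻¹ = u * x * u⁻¹) ∧ ∀ d ∈ D, h * d * h⁻¹ ∈ P := by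
  obtain ⟨ψ, ⟨h, hh⟩, hψ⟩ := hR Q hQP (conjEquiv hu) ⟨u, fun _ => rfl⟩
  refine ⟨h, fun x hx => ?_, fun d hd => ?_⟩
  · rw [← hh ⟨x, le_extender hQP hRP (conjEquiv hu) hx⟩]
    exact hψ ⟨x, hx⟩ _
  · have hmem : d ∈ extender P (conjEquiv hu) := by
      obtain ⟨t, ht, c, hc, htc⟩ := hD d hd
      refine mem_extender.2 ⟨hDP hd, hDQ hd, mem_autBy.2 ⟨t, ht, fun x => ?_⟩⟩
      rw [← conj_mul_centralizer hc x.2, ← htc]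
      change u * (d * (u⁻¹ * x * u) * d⁻¹) * u⁻¹ = _
      group
    rw [← hh ⟨d, hmem⟩]
    exact (ψ ⟨d, hmem⟩).2

/-- A fully normalized subgroup is carried, together with its normalizer in `P`, to a fully
automized receptive subgroup. -/
theorem FullyNormalized.exists_conj [Finite G] {P Q : Subgroup G} (hQ : FullyNormalized P Q)
    (hP : IsPGroup 2 P) (hsat : Saturated 2 P) :
    ∃ (R : Subgroup G) (g : G), R ≤ P ∧ FullyAutomized 2 P R ∧ Receptive P R ∧
      (∀ x, x ∈ Q ↔ g * x * g⁻¹ ∈ R) ∧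
      ∀ y, y ∈ P ⊓ Subgroup.normalizer (Q : Set G) ↔
        g * y * g⁻¹ ∈ P ⊓ Subgroup.normalizer (R : Set G) := by
  obtain ⟨hQP, hmax⟩ := hQ
  obtain ⟨R, hRP, hconj, haut, hrec⟩ := hsat Q hQP
  obtain ⟨φ, g₀, hφ⟩ := id hconj
  have hg₀ : ∀ x, x ∈ Q ↔ g₀ * x * g₀⁻¹ ∈ R := by
    intro x
    constructor
    · intro hx
      rw [← hφ ⟨x, hx⟩]
      exact (φ ⟨x, hx⟩).2
    · intro hx
      have h1 := hφ (φ.symm ⟨_, hx⟩)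
      rw [MulEquiv.apply_symm_apply] at h1
      have h2 : x = (φ.symm ⟨_, hx⟩ : Q) := by simpa using h1
      rw [h2]
      exact (φ.symm ⟨_, hx⟩ : Q).2
  set T := P ⊓ Subgroup.normalizer (Q : Set G) with hT
  -- Sylow's theorem in `Aut_G(R)` corrects `g₀` so that the image of `T` acts on `R` through `P`;
  -- the isomorphism given by `w * g₀` then extends to `T`.
  obtain ⟨w, hw, hwT⟩ := haut.exists_conj_le (T.map (MulAut.conj g₀).toMonoidHom)
    (by
      rintro _ ⟨y, hy, rfl⟩
      exact (conj_mem_normalizer_iff hg₀ y).1 hy.2)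
    (by
      rintro _ ⟨y, hy, rfl⟩
      obtain ⟨k, hk⟩ := hP ⟨y, hy.1⟩
      refine ⟨k, ?_⟩
      have hk' : y ^ 2 ^ k = 1 := congrArg Subtype.val hk
      rw [← map_pow, hk', map_one]
      exact one_mem _)
  have hu : ∀ x, x ∈ Q ↔ (w * g₀) * x * (w * g₀)⁻¹ ∈ R := by
    intro x
    rw [hg₀, Subgroup.mem_normalizer_iff.1 hw]
    have : w * (g₀ * x * g₀⁻¹) * w⁻¹ = (w * g₀) * x * (w * g₀)⁻¹ := by group
    rw [this]
  obtain ⟨g, hgu, hgT⟩ := hrec.exists_extension hQP hRP hu T inf_le_left inf_le_right (by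
    intro d hd
    obtain ⟨t, ht, c, hc, h⟩ := hwT _ ⟨d, hd, rfl⟩
    refine ⟨t, ht, c, hc, ?_⟩
    rw [← h]
    change _ = w * (g₀ * d * g₀⁻¹) * w⁻¹
    group)
  have hg : ∀ x, x ∈ Q ↔ g * x * g⁻¹ ∈ R := by
    intro x
    refine ⟨fun hx => by rw [hgu x hx]; exact (hu x).1 hx, fun hx => ?_⟩
    obtain ⟨y, hy⟩ := (conjEquiv hu).surjective ⟨_, hx⟩
    have h1 : (w * g₀) * y * (w * g₀)⁻¹ = g * x * g⁻¹ := congrArg Subtype.val hy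
    rw [← hgu y y.2] at h1
    have h2 : (y : G) = x := by simpa using h1
    rw [← h2]
    exact y.2
  have hle : T.map (MulAut.conj g).toMonoidHom ≤ P ⊓ Subgroup.normalizer (R : Set G) := by
    rintro _ ⟨y, hy, rfl⟩
    exact ⟨hgT y hy, (conj_mem_normalizer_iff hg y).1 hy.2⟩
  -- Full normalization enters here: `N_P(R)` is no larger than `T`, so the inclusion is an
  -- equality.
  have heq := Subgroup.eq_of_le_of_card_ge hle (by
    rw [Subgroup.card_map_of_injective (MulAut.conj g).injective]
    exact hmax R hRP hconj)
  refine ⟨R, g, hRP, haut, hrec, hg, fun y => ⟨fun hy => hle ⟨y, hy, rfl⟩, fun hy => ?_⟩⟩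
  rw [← heq] at hy
  obtain ⟨z, hz, hzy⟩ := hy
  have : z = y := (MulAut.conj g).injective hzy
  rwa [← this]

end Fusion

/-! ### The complement `K` and the conclusion -/

/-- The normal `p`-complement of the centralizer, as a subgroup of the normalizer. -/
theorem exists_normal_complement {G : Type*} [Group G] [Finite G] (Q : Subgroup G)
    (hnil : IsPNilpotent 2 (Subgroup.centralizer (Q : Set G))) :
    ∃ K : Subgroup (Subgroup.normalizer (Q : Set G)), K.Normal ∧
      K ≤ (Subgroup.centralizer (Q : Set G)).subgroupOf (Subgroup.normalizer (Q : Set G)) ∧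
      (Nat.card K).Coprime 2 ∧
      ∀ z ∈ (Subgroup.centralizer (Q : Set G)).subgroupOf (Subgroup.normalizer (Q : Set G)),
        ∃ k : ℕ, z ^ 2 ^ k ∈ K := by
  obtain ⟨K, hKn, hK2, k, hk⟩ := hnil
  have hpow : ∀ z : Subgroup.centralizer (Q : Set G), z ^ 2 ^ k ∈ K := fun z => by
    rw [← hk]
    exact K.pow_index_mem z
  -- By Bézout, `K` consists exactly of the `z` with `z ^ |K| = 1`. This condition is invariant
  -- under conjugation, so `K` is normal in the whole normalizer.
  have hodd : ∀ z : Subgroup.centralizer (Q : Set G), z ^ Nat.card K = 1 → z ∈ K := by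
    intro z hz
    have h1 : z ^ (Nat.gcd (Nat.card K) (2 ^ k) : ℤ) ∈ K := by
      rw [Nat.gcd_eq_gcd_ab, zpow_add, zpow_mul, zpow_mul, zpow_natCast, zpow_natCast, hz,
        one_zpow, one_mul]
      exact zpow_mem (hpow z) _
    rw [Nat.Coprime.pow_right k hK2] at h1
    simpa using h1
  set N := Subgroup.normalizer (Q : Set G) with hN
  let ι := Subgroup.inclusion (Subgroup.centralizer_le_normalizer (Q : Set G))
  have hι : Function.Injective ι := Subgroup.inclusion_injective _
  refine ⟨K.map ι, ⟨?_⟩, ?_, ?_, ?_⟩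
  · rintro _ ⟨z, hz, rfl⟩ g
    have hC : g * ι z * g⁻¹ ∈ (Subgroup.centralizer (Q : Set G)).subgroupOf N :=
      (inferInstance : ((Subgroup.centralizer (Q : Set G)).subgroupOf N).Normal).conj_mem _ z.2 g
    refine ⟨⟨_, hC⟩, hodd _ (Subtype.ext ?_), rfl⟩
    have hz1 : z ^ Nat.card K = 1 := by
      have h := pow_card_eq_one' (x := (⟨z, hz⟩ : K))
      exact congrArg Subtype.val h
    have h1 : (g * ι z * g⁻¹) ^ Nat.card K = 1 := by
      rw [conj_pow, ← map_pow, hz1, map_one, mul_one, mul_inv_cancel]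
    have h2 := congrArg N.subtype h1
    exact h2
  · rintro _ ⟨z, -, rfl⟩
    exact z.2
  · rwa [Subgroup.card_map_of_injective hι]
  · intro z hz
    exact ⟨k, ⟨z, hz⟩ ^ 2 ^ k, hpow _, rfl⟩

theorem exists_sylow_two_power_relIndex {G : Type*} [Group G] [Finite G] (P : Subgroup G) (n : ℕ) (hn : 2 ≤ n)
    (e : P ≃* Wreathed n)
    (hsat : Saturated 2 P)
    (Q : Subgroup G) (hlist : IsListed e Q)
    (hfn : FullyNormalized P Q)
    (hnil : IsPNilpotent 2 (Subgroup.centralizer (Q : Set G)))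
    (hnot : ¬ IsPGroup 2
      (Subgroup.normalizer (Q : Set G) ⧸ mulCentralizer Q)) :
    ∃ H : Subgroup G, H ≤ Subgroup.normalizer (Q : Set G) ∧
      IsSylowIn 2 (P ⊓ Subgroup.normalizer (Q : Set G)) H ∧
      ∃ k : ℕ, H.relIndex (Subgroup.normalizer (Q : Set G)) = 2 ^ k := by
  have hP : IsPGroup 2 P := isPGroup_of_mulEquiv_wreathed e
  obtain ⟨F, hF⟩ := exists_perm_hom_of_isListed (by omega) e Q hlist
  obtain ⟨R, g, hRP, haut, hrec, hg, hgT⟩ := hfn.exists_conj hP hsat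
  set N := Subgroup.normalizer (Q : Set G) with hN
  set C : Subgroup N := (Subgroup.centralizer (Q : Set G)).subgroupOf N with hC
  set T : Subgroup N := (P ⊓ N).subgroupOf N with hT
  obtain ⟨K, hKn, hKC, hK2, hCK⟩ := exists_normal_complement Q hnil
  have hTp : IsPGroup 2 (P ⊓ N : Subgroup G) := hP.to_le inf_le_left
  let f : N →* Perm (Fin 3) := F.comp Q.normalizerMonoidHom
  have hker : Q.normalizerMonoidHom.ker = C := Subgroup.normalizerMonoidHom_ker Q
  have hfC : ∀ z, f z = 1 → ∃ k : ℕ, z ^ 2 ^ k ∈ C := by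
    intro z hz
    obtain ⟨k, hk⟩ := hF _ hz
    refine ⟨k, ?_⟩
    rw [← hker, MonoidHom.mem_ker, map_pow]
    exact hk
  have hCn : C.Normal := hker ▸ inferInstance
  have hsyl : ∀ L : Subgroup N, L.Normal → (∀ z ∈ L, ∃ k : ℕ, z ^ 2 ^ k ∈ C) → L ≤ T ⊔ C := by
    intro L hL hL2 z hz
    obtain ⟨w, hw, hwL⟩ := haut.exists_conj_le
      ((L.map N.subtype).map (MulAut.conj g).toMonoidHom)
      (by
        rintro _ ⟨_, ⟨y, hy, rfl⟩, rfl⟩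
        exact (conj_mem_normalizer_iff hg y).1 y.2)
      (by
        rintro _ ⟨_, ⟨y, hy, rfl⟩, rfl⟩
        obtain ⟨k, hk⟩ := hL2 y hy
        refine ⟨k, ?_⟩
        rw [← map_pow, ← map_pow]
        exact (conj_mem_centralizer_iff hg _).1 hk)
    let v : N := ⟨g⁻¹ * w * g, (conj_mem_normalizer_iff hg _).2 (by
      have h2 : g * (g⁻¹ * w * g) * g⁻¹ = w := by group
      rw [h2]
      exact hw)⟩
    -- As `L` is normal it contains `v⁻¹ z v`, where `v` is `w` pulled back by `g`. Applying `hwL`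
    -- to this element cancels the conjugation by `w` and puts `z` itself in `TC`.
    obtain ⟨t, ht, c, hc, htc⟩ := hwL _ ⟨_, ⟨v⁻¹ * z * v⁻¹⁻¹, hL.conj_mem z hz v⁻¹, rfl⟩, rfl⟩
    have hz' : g * z * g⁻¹ = t * c := by
      rw [← htc]
      change g * z * g⁻¹ = w * (g * ((g⁻¹ * w * g)⁻¹ * z * (g⁻¹ * w * g)⁻¹⁻¹) * g⁻¹) * w⁻¹
      group
    have hc' : g⁻¹ * c * g ∈ Subgroup.centralizer (Q : Set G) :=
      (conj_mem_centralizer_iff hg _).2 (by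
        have h2 : g * (g⁻¹ * c * g) * g⁻¹ = c := by group
        rwa [h2])
    have ht' : z * (g⁻¹ * c * g)⁻¹ ∈ P ⊓ N := (hgT _).2 (by
      have h2 : g * (z * (g⁻¹ * c * g)⁻¹) * g⁻¹ = t := by
        calc g * (z * (g⁻¹ * c * g)⁻¹) * g⁻¹ = (g * z * g⁻¹) * c⁻¹ := by group
          _ = t := by rw [hz']; group
      refine ⟨by rwa [h2], (conj_mem_normalizer_iff hg _).1 ?_⟩
      exact N.mul_mem z.2 (N.inv_mem (Subgroup.centralizer_le_normalizer _ hc')))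
    have hz2 : z = ⟨_, ht'.2⟩ * ⟨_, Subgroup.centralizer_le_normalizer _ hc'⟩ :=
      Subtype.ext (inv_mul_cancel_right (z : G) (g⁻¹ * c * g)).symm
    rw [hz2]
    exact mul_mem (Subgroup.mem_sup_left ht') (Subgroup.mem_sup_right hc')
  have hext : ∀ (m : N) (D : Subgroup N), D ≤ T → (∀ d ∈ D, m * d * m⁻¹ ∈ T ⊔ C) →
      ∃ h : N, h⁻¹ * m ∈ C ∧ ∀ d ∈ D, h * d * h⁻¹ ∈ T := by
    intro m D hDT hD
    have hu : ∀ x, x ∈ Q ↔ (g * m) * x * (g * m)⁻¹ ∈ R := by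
      intro x
      rw [Subgroup.mem_normalizer_iff.1 m.2 x, hg]
      have : g * (m * x * (m : G)⁻¹) * g⁻¹ = g * m * x * (g * m)⁻¹ := by group
      rw [this]
    -- The receptive subgroup is `R`, so the map by `m` is followed by `g` before extending; the
    -- required element is then `g⁻¹ * h`.
    obtain ⟨h, hhu, hhD⟩ := hrec.exists_extension hfn.1 hRP hu (D.map N.subtype)
      (by
        rintro _ ⟨d, hd, rfl⟩
        exact (hDT hd).1)
      (by
        rintro _ ⟨d, hd, rfl⟩
        exact d.2)
      (by
        rintro _ ⟨d, hd, rfl⟩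
        obtain ⟨t, ht, c, hc, htc⟩ := Subgroup.mem_sup_of_normal_right.1 (hD d hd)
        refine ⟨g * t * g⁻¹, ((hgT _).1 ht).1, g * c * g⁻¹,
          (conj_mem_centralizer_iff hg _).1 hc, ?_⟩
        have h1 : (t : G) * c = m * d * (m : G)⁻¹ := congrArg Subtype.val htc
        calc g * m * d * (g * m)⁻¹ = g * (m * d * (m : G)⁻¹) * g⁻¹ := by group
          _ = g * t * g⁻¹ * (g * c * g⁻¹) := by rw [← h1]; group)
    have hgh : g⁻¹ * h ∈ N := by
      refine Subgroup.mem_normalizer_fintype fun x hx => (hg _).2 ?_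
      have : g * (g⁻¹ * h * x * (g⁻¹ * h)⁻¹) * g⁻¹ = h * x * h⁻¹ := by group
      rw [this, hhu x hx]
      exact (hu x).1 hx
    refine ⟨⟨g⁻¹ * h, hgh⟩, ?_, fun d hd => ?_⟩
    · have h1 := inv_mul_mem_centralizer (R := Q) (u := g * m) (t := h) fun x hx => (hhu x hx).symm
      have h2 : h⁻¹ * (g * m) = (g⁻¹ * h)⁻¹ * m := by group
      rw [h2] at h1
      exact h1
    · have hmem : g⁻¹ * h * d * (g⁻¹ * h)⁻¹ ∈ N :=
        N.mul_mem (N.mul_mem hgh d.2) (N.inv_mem hgh)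
      refine (hgT _).2 ⟨?_, (conj_mem_normalizer_iff hg _).1 hmem⟩
      have h1 := hhD d ⟨d, hd, rfl⟩
      have h2 : g * (g⁻¹ * h * d * (g⁻¹ * h)⁻¹) * g⁻¹ = h * d * h⁻¹ := by group
      rw [← h2] at h1
      exact h1
  obtain ⟨x, hx⟩ : ∃ x : N, ∀ k : ℕ, x ^ 2 ^ k ∉ C := by
    by_contra! hcon
    refine hnot fun y => ?_
    obtain ⟨y, rfl⟩ := QuotientGroup.mk_surjective y
    obtain ⟨k, hk⟩ := hcon y
    refine ⟨k, ?_⟩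
    rw [← QuotientGroup.mk_pow, QuotientGroup.eq_one_iff]
    exact Subgroup.mem_sup_right (S := Q) hk
  -- Squaring removes a possible transposition: every square in `S_3` has trivial cube, so `f (x ^
  -- 2)` has order 3.
  have hx1 : f (x ^ 2) ≠ 1 := by
    intro h
    obtain ⟨k, hk⟩ := hfC _ h
    exact hx (k + 1) (by rwa [pow_succ', pow_mul])
  obtain ⟨H, hTH, hodd, k, hk⟩ := exists_sylow_two_power_index C K T hKC hK2 hCK
    (hTp.comap_of_injective N.subtype Subtype.val_injective) f
    (by
      rw [← hker]
      intro z hz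
      change F (Q.normalizerMonoidHom z) = 1
      rw [MonoidHom.mem_ker.1 hz, map_one])
    hfC hsyl hext (x ^ 2) (by 
      rcases perm_sq_or_cube (f x) with h | h
      · rw [map_pow, h, one_pow]
      · rw [map_pow, ← pow_mul, mul_comm, pow_mul, h, one_pow]) hx1
  have hTmap : T.map N.subtype = P ⊓ N := Subgroup.map_subgroupOf_eq_of_le inf_le_right
  have hle : P ⊓ N ≤ H.map N.subtype := hTmap ▸ Subgroup.map_mono hTH
  refine ⟨H.map N.subtype, Subgroup.map_subtype_le H, ⟨hle, ?_⟩, k, ?_⟩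
  · have hp : IsPGroup 2 ((P ⊓ N).subgroupOf (H.map N.subtype)) :=
      hTp.comap_of_injective (H.map N.subtype).subtype Subtype.val_injective
    refine ⟨hp.toSylow ?_, rfl⟩
    change ¬ 2 ∣ (P ⊓ N).relIndex (H.map N.subtype)
    rwa [← hTmap, Subgroup.relIndex_map_map_of_injective _ _ Subtype.val_injective]
  · rw [Subgroup.relIndex, Subgroup.subgroupOf, Subgroup.comap_map_eq_self_of_injective
      Subtype.val_injective, hk]

end FusionSys

theorem mainTheorem3 {G : Type*} [Group G] [Finite G] (P : Subgroup G) (n : ℕ) (hn : 2 ≤ n)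
    (e : P ≃* FusionSys.Wreathed n)
    (hsat : FusionSys.Saturated 2 P)
    (Q : Subgroup G) (hlist : FusionSys.IsListed e Q)
    (hfn : FusionSys.FullyNormalized P Q)
    (hnil : FusionSys.IsPNilpotent 2 (Subgroup.centralizer (Q : Set G)))
    (hnot : ¬ IsPGroup 2
      (Subgroup.normalizer (Q : Set G) ⧸ FusionSys.mulCentralizer Q)) :
    ∃ H : Subgroup G, H ≤ Subgroup.normalizer (Q : Set G) ∧
      FusionSys.IsSylowIn 2 (P ⊓ Subgroup.normalizer (Q : Set G)) H ∧
      ∃ k : ℕ, H.relIndex (Subgroup.normalizer (Q : Set G)) = 2 ^ k :=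
  FusionSys.exists_sylow_two_power_relIndex P n hn e hsat Q hlist hfn hnil hnot
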